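/- A one-tape Turing machine is a deterministic machine $M=(Q,\Sigma,\Gamma,\sqcup,\delta,q_0,q_{\mathrm{acc}},q_{\mathrm{rej}})$ with finite sets $Q$ of states and $\Gamma$ of tape symbols, a nonempty input alphabet $\Sigma\subseteq\Gamma\setminus\{\sqcup\}$, pairwise distinct states $q_0,q_{\mathrm{acc}},q_{\mathrm{rej}}$, and one two-way infinite read-write tape that initially holds the input, with the head on the first input cell; at each step the head moves one cell left or right, and $M$ halts when it enters $q_{\mathrm{acc}}$ or $q_{\mathrm{rej}}$. For $T:\mathbb{N}\to\mathbb{R}_{\ge 0}$, $M$ runs in time $T(n)$ if, for each $n\in\mathbb{N}$, $M$ halts after at most $T(n)$ steps on every input of length $n$. For a class $\mathcal{F}$ of functions $\mathbb{N}\to\mathbb{R}_{\ge 0}$, let $\mathrm{HALT}^1_{\mathcal{F}}$ be the problem of deciding, given (a canonical encoding of) a one-tape Turing machine $M$, whether $M$ runs in time $T(n)$ for some $T\in\mathcal{F}$. A problem is undecidable if no algorithm halts on the encodings of all one-tape Turing machines and accepts exactly the encodings of those with the property in question. Theorem. Let $\mathcal{F}$ be a class of functions $\mathbb{N}\to\mathbb{R}_{\ge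 0}$ that contains arbitrarily large constants, that is, for every $K\ge 0$ some constant function $n\mapsto c$ with $c\ge K$ belongs to $\mathcal{F}$. Then $\mathrm{HALT}^1_{\mathcal{F}}$ is undecidable. In particular, the following problems are undecidable: (i) $\mathrm{HALT}^1_{\mathcal{F}}$ for $\mathcal{F}$ the class of polynomials; (ii) $\mathrm{HALT}^1_{\mathcal{F}}$ for $\mathcal{F}$ the class of exponential functions, whether these are taken to be the functions $2^{p(n)}$ with $p$ a polynomial or the functions $c\,b^n$ with constants $b,c\ge 0$; (iii) $\mathrm{HALT}^1_{O(T(n))}$ for every $T:\mathbb{N}\to\mathbb{R}_{\ge 0}$ with $T(n)=\Omega(1)$; (iv) $\mathrm{HALT}^1_{O(1)}$. Here $f(n)=O(g(n))$ (respectively $f(n)=\Omega(g(n))$) means that there are $k>0$ and $n_0\in\mathbb{N}$ with $f(n)\le k\,g(n)$ (respectively $f(n)\ge k\,g(n)$) for all $n\ge n_0$. -/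

import Mathlib

open scoped NNReal

/-- A deterministic one-tape Turing machine with state set `Q` and tape alphabet `Γ`.
`δ q a = (q', b, right)` means: in state `q` reading `a`, write `b`, change the state to `q'` and
move the head one cell to the right if `right = true` and one cell to the left otherwise
(the head moves at each step). The values of `δ` at the two halting states are never used. -/
structure OneTapeTM (Q Γ : Type) where
  inputAlphabet : Finset Γ
  blank : Γ
  δ : Q → Γ → Q × Γ × Bool
  start : Q
  accept : Q
  reject : Q
  inputAlphabet_nonempty : inputAlphabet.Nonempty
  blank_notMem : blank ∉ inputAlphabet
  start_ne_accept : start ≠ accept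
  start_ne_reject : start ≠ reject
  accept_ne_reject : accept ≠ reject

namespace OneTapeTM

/-- A configuration: the state, the position of the head, and the content of the two-way infinite
tape, whose cells are numbered by the integers. -/
structure Cfg (Q Γ : Type) where
  state : Q
  head : ℤ
  tape : ℤ → Γ

variable {Q Γ : Type} (M : OneTapeTM Q Γ)

/-- `w` is a word over the input alphabet. -/
def IsInput (w : List Γ) : Prop := ∀ a ∈ w, a ∈ M.inputAlphabet

/-- The starting configuration: the `i`-th letter of `w` is in the cell `i - 1`, all other cells are
blank, and the head is on the cell `0`. -/
def init (w : List Γ) : Cfg Q Γ where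
  state := M.start
  head := 0
  tape := fun i => if 0 ≤ i then w.getD i.toNat M.blank else M.blank

/-- One application of the transition function. -/
def step (c : Cfg Q Γ) : Cfg Q Γ :=
  let r := M.δ c.state (c.tape c.head)
  { state := r.1
    head := if r.2.2 then c.head + 1 else c.head - 1
    tape := Function.update c.tape c.head r.2.1 }

/-- The configuration after `t` applications of the transition function on input `w`
(meaningful as long as no halting state was reached earlier). -/
def run (w : List Γ) (t : ℕ) : Cfg Q Γ := M.step^[t] (M.init w)

/-- The configuration is in the accepting or in the rejecting state. -/
def IsHalted (c : Cfg Q Γ) : Prop := c.state = M.accept ∨ c.state = M.reject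

/-- On input `w` the machine halts after making exactly `t` steps: `t` is the first time at which
it is in a halting state. -/
def HaltsInSteps (w : List Γ) (t : ℕ) : Prop :=
  M.IsHalted (M.run w t) ∧ ∀ s < t, ¬ M.IsHalted (M.run w s)

/-- The machine runs in time `T(n)`: for each `n`, on each input of length `n` it halts after making
at most `T(n)` steps. -/
def RunsInTime (T : ℕ → ℝ≥0) : Prop :=
  ∀ w : List Γ, M.IsInput w → ∃ t : ℕ, M.HaltsInSteps w t ∧ (t : ℝ≥0) ≤ T w.length

end OneTapeTM

/-- The objects given to a decision procedure: one-tape Turing machines with finitely many states,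
named `0, …, numStates - 1`, and finitely many tape symbols, named `0, …, numSymbols - 1`.
Up to the names of states and symbols, these are all one-tape Turing machines. -/
structure FiniteTM where
  numStates : ℕ
  numSymbols : ℕ
  tm : OneTapeTM (Fin numStates) (Fin numSymbols)

/-- Descriptions of one-tape Turing machines: number of states, number of symbols, the increasing
list of the input symbols, the blank symbol, the starting, accepting and rejecting states, and the
table of the transition function, one row for each state and one entry for each symbol. -/
abbrev TMCode : Type :=
  ℕ × ℕ × List ℕ × ℕ × (ℕ × ℕ × ℕ) × List (List (ℕ × ℕ × Bool))

/-- The canonical encoding of one-tape Turing machines. -/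
def FiniteTM.code (M : FiniteTM) : TMCode :=
  ( M.numStates,
    M.numSymbols,
    ((List.finRange M.numSymbols).filter (fun a => a ∈ M.tm.inputAlphabet)).map Fin.val,
    M.tm.blank.val,
    (M.tm.start.val, M.tm.accept.val, M.tm.reject.val),
    List.ofFn fun q : Fin M.numStates => List.ofFn fun a : Fin M.numSymbols =>
      ((M.tm.δ q a).1.val, (M.tm.δ q a).2.1.val, (M.tm.δ q a).2.2) )

/-- Different machines have different codes. -/
theorem FiniteTM.code_injective : Function.Injective FiniteTM.code := by
  rintro ⟨k, m, ⟨A, b, d, s, x, r, _, _, _, _, _⟩⟩ ⟨k', m', ⟨A', b', d', s', x', r', _, _, _, _, _⟩⟩ h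
  simp only [FiniteTM.code, Prod.mk.injEq] at h
  obtain ⟨rfl, rfl, hA, hb, ⟨hs, hx, hr⟩, hd⟩ := h
  have hA' : A = A' := by
    have h1 := List.map_injective_iff.2 Fin.val_injective hA
    ext a
    have h2 := congrArg (fun l => a ∈ l) h1
    simpa using h2
  have hd' : d = d' := by
    funext q a
    have h1 := congrFun (List.ofFn_injective hd) q
    have h2 := congrFun (List.ofFn_injective h1) a
    simp only [Prod.mk.injEq] at h2
    exact Prod.ext (Fin.ext h2.1) (Prod.ext (Fin.ext h2.2.1) h2.2.2)
  have hb' := Fin.ext hb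
  have hs' := Fin.ext hs
  have hx' := Fin.ext hx
  have hr' := Fin.ext hr
  subst hA' hd' hb' hs' hx' hr'
  rfl

/-- The problem `L ⊆ {one-tape Turing machines}` is decidable: some algorithm halts on the codes of
all one-tape Turing machines and accepts exactly the codes of the elements of `L`. (What it does
on inputs that are not codes of machines is irrelevant.) -/
def DecidableProblem (L : Set FiniteTM) : Prop :=
  ∃ f : TMCode →. Bool, Partrec f ∧
    ∀ M : FiniteTM, (M ∈ L → true ∈ f M.code) ∧ (M ∉ L → false ∈ f M.code)

/-- The one-tape Turing machines that run in time `T(n)` for some `T ∈ F`. -/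
def haltOne (F : Set (ℕ → ℝ≥0)) : Set FiniteTM :=
  {M | ∃ T ∈ F, M.tm.RunsInTime T}

/-- `F` contains arbitrarily large constants. -/
def HasArbitrarilyLargeConstants (F : Set (ℕ → ℝ≥0)) : Prop :=
  ∀ K : ℝ≥0, ∃ c : ℝ≥0, K ≤ c ∧ (fun _ : ℕ => c) ∈ F

/-- The class of polynomials. -/
def polyClass : Set (ℕ → ℝ≥0) :=
  {f | ∃ p : Polynomial ℝ, ∀ n : ℕ, (f n : ℝ) = p.eval (n : ℝ)}

/-- The class of the functions `2 ^ p(n)` for polynomials `p`. -/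
def expClass : Set (ℕ → ℝ≥0) :=
  {f | ∃ p : Polynomial ℝ, ∀ n : ℕ, (f n : ℝ) = (2 : ℝ) ^ (p.eval (n : ℝ))}

/-- The class of the functions `c * b ^ n` for constants `b` and `c`. -/
def simpleExpClass : Set (ℕ → ℝ≥0) :=
  {f | ∃ b c : ℝ≥0, ∀ n : ℕ, f n = c * b ^ n}

/-- The class `O(T(n))`. -/
def bigO (T : ℕ → ℝ≥0) : Set (ℕ → ℝ≥0) :=
  {f | ∃ k : ℝ≥0, 0 < k ∧ ∃ n₀ : ℕ, ∀ n ≥ n₀, f n ≤ k * T n}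

/-- The class `Ω(T(n))`. -/
def bigOmega (T : ℕ → ℝ≥0) : Set (ℕ → ℝ≥0) :=
  {f | ∃ k : ℝ≥0, 0 < k ∧ ∃ n₀ : ℕ, ∀ n ≥ n₀, f n ≥ k * T n}

/-!
The halting problem for partial recursive functions is reduced to `haltOne F`, by one reduction for
all classes `F`.

If a machine treats every input letter exactly as the blank symbol, then its computation is the
same on all inputs (`OneTapeTM.IgnoresInput.state_run_eq`). Hence either it halts on all inputs after
the same number of steps, or on none of them. When `F` contains arbitrarily large constants, such a
machine therefore belongs to `haltOne F` if and only if it halts on the blank tape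
(`mem_haltOne_iff_haltsFrom`), and it remains to see that halting on the blank tape is undecidable,
even for machines of this kind.

Mathlib compiles a partial recursive function into a stack machine and further into a `TM0` machine.
Applied once, to a function with an undecidable domain, this gives a single fixed machine `T`, so
that the computability of the compilation is not needed. Only the input has to vary. Feeding `T` the
powers `2 ^ m`, whose encodings are `b₁ b₂ b ⋯ b` (`exists_TM0_eval_dom_iff`), the one-tape machine
for `m` consists of a part that does not depend on `m` and of `m + 1` states that write the letters
`b`. Its transition table is a constant table followed by uniform rows, so that its code is
a primitive recursive function of `m` (`primrec_finiteSimulator_code`), and it halts on the blank tape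
if and only if `T` halts on the encoding of the power of two (`simulator_haltsFrom_init`).
-/

/-! ### Halting from a configuration -/

namespace OneTapeTM

open StateTransition

variable {Q Γ : Type} (M : OneTapeTM Q Γ)

/-- The machine reaches a halting state when it is started in the configuration `c`. -/
def HaltsFrom (c : Cfg Q Γ) : Prop := ∃ t, M.IsHalted (M.step^[t] c)

theorem haltsFrom_of_step {c : Cfg Q Γ} (h : M.HaltsFrom (M.step c)) : M.HaltsFrom c :=
  h.imp' (· + 1) fun _ ht => ht

theorem haltsFrom_step_iff {c : Cfg Q Γ} (hc : ¬ M.IsHalted c) :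
    M.HaltsFrom (M.step c) ↔ M.HaltsFrom c := by
  refine ⟨M.haltsFrom_of_step, ?_⟩
  rintro ⟨_ | t, ht⟩
  · exact absurd ht hc
  · exact ⟨t, ht⟩

open Classical in
/-- The step function as a partial function in the sense of `StateTransition`, undefined at the
configurations whose successor is halted. Mathlib's `TM0` machines halt by having no transition,
a `OneTapeTM` by one more step into a halting state; stopping one step early makes the two agree. -/
noncomputable def stepUnlessHalting (c : Cfg Q Γ) : Option (Cfg Q Γ) :=
  if M.IsHalted (M.step c) then none else some (M.step c)

theorem eval_stepUnlessHalting_dom {c : Cfg Q Γ} (hc : ¬ M.IsHalted c) :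
    (eval M.stepUnlessHalting c).Dom ↔ M.HaltsFrom c := by
  constructor
  · intro h
    obtain ⟨b, hb⟩ := Part.dom_iff_mem.1 h
    obtain ⟨hr, hbn⟩ := mem_eval.1 hb
    have hb' : M.HaltsFrom b := by
      by_contra hn
      have : ¬ M.IsHalted (M.step b) := fun h => hn ⟨1, h⟩
      simp [stepUnlessHalting, this] at hbn
    clear h hc hb hbn
    induction hr using Relation.ReflTransGen.head_induction_on with
    | refl => exact hb'
    | head h _ ih =>
      refine M.haltsFrom_of_step ?_
      simp only [stepUnlessHalting, Option.mem_def] at h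
      split_ifs at h
      rwa [Option.some.inj h]
  · rintro ⟨t, ht⟩
    induction t generalizing c with
    | zero => exact absurd ht hc
    | succ t ih =>
      by_cases hs : M.IsHalted (M.step c)
      · exact Part.dom_iff_mem.2 ⟨c, mem_eval.2 ⟨.refl, by simp [stepUnlessHalting, hs]⟩⟩
      · rw [reaches_eval (b := M.step c) (.single (by simp [stepUnlessHalting, hs]))]
        exact ih hs ht

theorem haltsFrom_init_iff (w : List Γ) :
    M.HaltsFrom (M.init w) ↔ ∃ t, M.HaltsInSteps w t := by
  classical
  exact ⟨fun h => ⟨Nat.find h, Nat.find_spec h, fun _ hs => Nat.find_min h hs⟩,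
    fun ⟨t, ht⟩ => ⟨t, ht.1⟩⟩

/-! ### Machines that do not distinguish input letters from blanks -/

/-- The machine treats every input letter exactly as the blank symbol. -/
def IgnoresInput : Prop := ∀ q, ∀ a ∈ M.inputAlphabet, M.δ q a = M.δ q M.blank

variable {M}

/-- The computations on `w` and on the empty word run in parallel: at each time the states and the
head positions agree, and where the tapes differ, both hold an input letter or a blank. -/
theorem IgnoresInput.state_run_eq (hM : M.IgnoresInput) {w : List Γ} (hw : M.IsInput w) (t : ℕ) :
    (M.run w t).state = (M.run [] t).state := by
  let B : Set Γ := {a | a ∈ M.inputAlphabet ∨ a = M.blank}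
  have hB : ∀ a ∈ B, ∀ q, M.δ q a = M.δ q M.blank := by
    rintro a (ha | rfl) q
    exacts [hM q a ha, rfl]
  suffices H : (M.run w t).state = (M.run [] t).state ∧ (M.run w t).head = (M.run [] t).head ∧
      ∀ i, (M.run w t).tape i = (M.run [] t).tape i ∨
        ((M.run w t).tape i ∈ B ∧ (M.run [] t).tape i ∈ B) from H.1
  induction t with
  | zero =>
    refine ⟨rfl, rfl, fun i => .inr ⟨?_, ?_⟩⟩
    · change (if 0 ≤ i then w.getD i.toNat M.blank else M.blank) ∈ B
      split_ifs
      · rw [List.getD_eq_getElem?_getD]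
        rcases h : w[i.toNat]? with _ | a
        · exact .inr rfl
        · exact .inl (hw a (List.mem_of_getElem? h))
      · exact .inr rfl
    · exact .inr (by simp [run, init])
  | succ t ih =>
    obtain ⟨hs, hh, ht⟩ := ih
    simp only [run, Function.iterate_succ_apply'] at hs hh ht ⊢
    have hδ : M.δ (M.step^[t] (M.init w)).state
          ((M.step^[t] (M.init w)).tape (M.step^[t] (M.init [])).head) =
        M.δ (M.step^[t] (M.init [])).state
          ((M.step^[t] (M.init [])).tape (M.step^[t] (M.init [])).head) := by
      rw [hs]
      rcases ht (M.step^[t] (M.init [])).head with h | ⟨h₁, h₂⟩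
      · rw [h]
      · rw [hB _ h₁, hB _ h₂]
    refine ⟨?_, ?_, fun i => ?_⟩
    · simp only [step, hh, hδ]
    · simp only [step, hh, hδ]
    · simp only [step, hh, hδ, Function.update_apply]
      split_ifs
      exacts [.inl rfl, ht i]

/-- A machine that ignores its input and halts on the empty word halts on all inputs after the same
number of steps. -/
theorem IgnoresInput.haltsInSteps (hM : M.IgnoresInput) {t : ℕ} (h : M.HaltsInSteps [] t)
    {w : List Γ} (hw : M.IsInput w) : M.HaltsInSteps w t := by
  simpa only [HaltsInSteps, IsHalted, hM.state_run_eq hw] using h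

end OneTapeTM

/-- For machines that ignore their input, running in time `T(n)` for some `T ∈ F` is the same as
halting on the blank tape: the running time of such a machine is constant. -/
theorem mem_haltOne_iff_haltsFrom {F : Set (ℕ → ℝ≥0)} (hF : HasArbitrarilyLargeConstants F)
    {M : FiniteTM} (hM : M.tm.IgnoresInput) :
    M ∈ haltOne F ↔ M.tm.HaltsFrom (M.tm.init []) := by
  rw [OneTapeTM.haltsFrom_init_iff]
  constructor
  · rintro ⟨T, -, hT⟩
    obtain ⟨t, ht, -⟩ := hT [] (by simp [OneTapeTM.IsInput])
    exact ⟨t, ht⟩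
  · rintro ⟨t, ht⟩
    obtain ⟨c, hc, hcF⟩ := hF t
    exact ⟨_, hcF, fun w hw => ⟨t, hM.haltsInSteps ht hw, hc⟩⟩

/-! ### Renaming states and symbols -/

namespace OneTapeTM

variable {Q Γ Q' Γ' : Type} (M : OneTapeTM Q Γ) (e : Q ≃ Q') (f : Γ ≃ Γ')

/-- The machine with its states renamed along `e` and its symbols along `f`. -/
def relabel : OneTapeTM Q' Γ' where
  inputAlphabet := M.inputAlphabet.map f.toEmbedding
  blank := f M.blank
  δ q a :=
    let r := M.δ (e.symm q) (f.symm a)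
    (e r.1, f r.2.1, r.2.2)
  start := e M.start
  accept := e M.accept
  reject := e M.reject
  inputAlphabet_nonempty := M.inputAlphabet_nonempty.map
  blank_notMem := by simpa using M.blank_notMem
  start_ne_accept := e.injective.ne M.start_ne_accept
  start_ne_reject := e.injective.ne M.start_ne_reject
  accept_ne_reject := e.injective.ne M.accept_ne_reject

/-- The configuration with its state renamed along `e` and its symbols along `f`. -/
def Cfg.relabel (c : Cfg Q Γ) : Cfg Q' Γ' := ⟨e c.state, c.head, fun i => f (c.tape i)⟩

theorem relabel_step (c : Cfg Q Γ) :
    (M.relabel e f).step (c.relabel e f) = (M.step c).relabel e f := by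
  simp only [step, relabel, Cfg.relabel, Equiv.symm_apply_apply, Cfg.mk.injEq, true_and]
  funext i
  simp only [Function.update_apply]
  split_ifs <;> rfl

theorem relabel_haltsFrom_init_nil :
    (M.relabel e f).HaltsFrom ((M.relabel e f).init []) ↔ M.HaltsFrom (M.init []) := by
  have h0 : (M.relabel e f).init [] = (M.init []).relabel e f := by
    simp [init, relabel, Cfg.relabel]
  have hc : ∀ c : Cfg Q Γ, (M.relabel e f).IsHalted (c.relabel e f) ↔ M.IsHalted c := fun c => by
    simp [IsHalted, relabel, Cfg.relabel]
  rw [h0]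
  refine exists_congr fun t => ?_
  rw [← hc, ← Function.Semiconj.iterate_right (f := Cfg.relabel e f)
    (fun c => (M.relabel_step e f c).symm) t (M.init [])]

theorem IgnoresInput.relabel {M : OneTapeTM Q Γ} (hM : M.IgnoresInput) :
    (M.relabel e f).IgnoresInput := by
  intro q a ha
  obtain ⟨b, hb, rfl⟩ := Finset.mem_map.1 ha
  simp [OneTapeTM.relabel, hM _ b hb]

end OneTapeTM

/-! ### A one-tape machine that writes a word and then simulates a `TM0` machine -/

open Turing StateTransition

/-- States of the part of the machine that does not depend on the length of the word: `sim q`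
simulates the state `q`, `back q` steps back to the left after the head has moved right in the
simulation of a writing step without a move, `writeSnd`, `writeFst` and `enter` prepare the tape. -/
inductive Control (Λ : Type) : Type
  | sim (q : Λ)
  | back (q : Λ)
  | writeSnd
  | writeFst
  | enter
  | accept
  | reject

instance {Λ : Type} [Finite Λ] : Finite (Control Λ) := by
  let g : Λ ⊕ Λ ⊕ Fin 5 → Control Λ :=
    Sum.elim .sim (Sum.elim .back ![.writeSnd, .writeFst, .enter, .accept, .reject])
  refine Finite.of_surjective g ?_
  rintro (q | q | _ | _ | _ | _ | _)
  exacts [⟨.inl q, rfl⟩, ⟨.inr (.inl q), rfl⟩, ⟨.inr (.inr 0), rfl⟩, ⟨.inr (.inr 1), rfl⟩,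
    ⟨.inr (.inr 2), rfl⟩, ⟨.inr (.inr 3), rfl⟩, ⟨.inr (.inr 4), rfl⟩]

section Simulator

variable {Λ G : Type} [Inhabited Λ] [Inhabited G]

/-- The transition function on the states `Control S`. The tape alphabet is `Option G`, where the
extra symbol `none` is the only input letter, read as the blank symbol `default`. The set `S`
contains the reachable states of `T`; a state outside `S` is replaced by the initial one. -/
def controlStep (T : TM0.Machine G Λ) (S : Set Λ) (hS : default ∈ S) [DecidablePred (· ∈ S)]
    (b₁ b₂ : G) : Control S → Option G → Control S × Option G × Bool
  | .sim q, a =>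
    let restrict (p : Λ) : S := if h : p ∈ S then ⟨p, h⟩ else ⟨default, hS⟩
    match T q (a.getD default) with
    | none => (.accept, some (a.getD default), true)
    | some (p, .move d) => (.sim (restrict p), some (a.getD default), decide (d = Dir.right))
    | some (p, .write b) => (.back (restrict p), some b, true)
  | .back q, a => (.sim q, some (a.getD default), false)
  | .writeSnd, _ => (.writeFst, some b₂, false)
  | .writeFst, _ => (.enter, some b₁, false)
  | .enter, a => (.sim ⟨default, hS⟩, some (a.getD default), true)
  | .accept, a => (.accept, some (a.getD default), true)
  | .reject, a => (.reject, some (a.getD default), true)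

/-- The machine that, ignoring its input, writes the word `b₁ b₂ b ⋯ b` with `m + 1` letters `b`
from right to left and then simulates `T` on it. The state `inr j` writes `b` and `j` further
letters `b`. -/
def simulator (T : TM0.Machine G Λ) (S : Set Λ) (hS : default ∈ S) [DecidablePred (· ∈ S)]
    (b₁ b₂ b : G) (m : ℕ) : OneTapeTM (Control S ⊕ Fin (m + 1)) (Option G) where
  inputAlphabet := {none}
  blank := some default
  δ
    | .inl q, a =>
      let r := controlStep T S hS b₁ b₂ q a
      (.inl r.1, r.2)
    | .inr j, _ =>
      (if (j : ℕ) = 0 then .inl .writeSnd else .inr ⟨j - 1, by omega⟩, some b, false)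
  start := .inr (Fin.last m)
  accept := .inl .accept
  reject := .inl .reject
  inputAlphabet_nonempty := Finset.singleton_nonempty _
  blank_notMem := by simp
  start_ne_accept := by simp
  start_ne_reject := by simp
  accept_ne_reject := by simp

namespace OneTapeTM

/-- The tape of `c`, seen from the head and with `none` read as `default`, is `t`. -/
def Cfg.Shows {Q : Type} (c : Cfg Q (Option G)) (t : Tape G) : Prop :=
  ∀ i : ℤ, (c.tape (c.head + i)).getD default = t.nth i

theorem Cfg.Shows.head_eq {Q : Type} {c : Cfg Q (Option G)} {t : Tape G} (h : c.Shows t) :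
    (c.tape c.head).getD default = t.head := by
  simpa using h 0

/-- Since every step moves the head, one step of the machine acts on the tape seen from the head as
a write followed by a move. -/
theorem Cfg.Shows.step {Q : Type} {M : OneTapeTM Q (Option G)} {c : Cfg Q (Option G)} {t : Tape G}
    (h : c.Shows t) {q : Q} {b : G} {d : Bool}
    (hδ : M.δ c.state (c.tape c.head) = (q, some b, d)) :
    (M.step c).state = q ∧
      (M.step c).Shows ((t.write b).move (if d then Dir.right else Dir.left)) := by
  refine ⟨by simp [OneTapeTM.step, hδ], fun i => ?_⟩
  cases d
  · have := h (i - 1)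
    simp only [OneTapeTM.step, hδ, Bool.false_eq_true, if_false, Tape.move_left_nth,
      Tape.write_nth, Function.update_apply, ← this, show c.head - 1 + i = c.head + (i - 1) by ring,
      add_eq_left]
    split_ifs <;> rfl
  · have := h (i + 1)
    simp only [OneTapeTM.step, hδ, if_true, Tape.move_right_nth,
      Tape.write_nth, Function.update_apply, ← this, show c.head + 1 + i = c.head + (i + 1) by ring,
      add_eq_left]
    split_ifs <;> rfl

end OneTapeTM

section Simulation

open OneTapeTM

variable (T : TM0.Machine G Λ) (S : Set Λ) (hS : default ∈ S) [DecidablePred (· ∈ S)]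
  (b₁ b₂ b : G) (m : ℕ)

theorem simulator_ignoresInput : (simulator T S hS b₁ b₂ b m).IgnoresInput := by
  intro q a ha
  obtain rfl : a = none := by simpa [simulator] using ha
  rcases q with (q | q | _ | _ | _ | _ | _) | j <;> rfl

/-- A configuration of the simulator represents a configuration of `T`. -/
def Represents (x : TM0.Cfg G Λ) (c : Cfg (Control S ⊕ Fin (m + 1)) (Option G)) : Prop :=
  (∃ h : x.q ∈ S, c.state = .inl (.sim ⟨x.q, h⟩)) ∧ c.Shows x.Tape

/-- The simulator carries out each step of `T` in one step, or in two steps if `T` writes, and is one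
step from accepting when `T` halts. -/
theorem simulator_respects (hT : TM0.Supports T S) :
    Respects (TM0.step T) (simulator T S hS b₁ b₂ b m).stepUnlessHalting
      (Represents S m) := by
  set M := simulator T S hS b₁ b₂ b m with hM
  have hH (x) : M.IsHalted x ↔ x.state = .inl .accept ∨ x.state = .inl .reject := .rfl
  rintro ⟨q, t⟩ c ⟨⟨hq, hc⟩, ht⟩
  have hδ : M.δ c.state (c.tape c.head) = _ :=
    (congrFun (congrArg M.δ hc) _).trans
      (show _ = ((.inl (controlStep T S hS b₁ b₂ (.sim ⟨q, hq⟩) (c.tape c.head)).1, _, _) :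
        (Control S ⊕ Fin (m + 1)) × Option G × Bool) from rfl)
  have hhead := ht.head_eq
  simp only at hhead
  simp only [controlStep, hhead] at hδ
  rcases hTq : T q t.head with _ | ⟨p, d | a⟩
  · simp only [hTq] at hδ
    have h1 := (ht.step hδ).1
    simp [TM0.step, hTq, stepUnlessHalting, hH, h1]
  · have hp : p ∈ S := hT.2 hTq hq
    simp only [hTq, hp, dite_true] at hδ
    obtain ⟨h1, h2⟩ := ht.step hδ
    have hstep : TM0.step T ⟨q, t⟩ = some ⟨p, t.move d⟩ := by simp [TM0.step, hTq]
    rw [hstep]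
    refine ⟨M.step c, ⟨⟨hp, h1⟩, ?_⟩, .single ?_⟩
    · cases d <;> simpa using h2
    · simp [stepUnlessHalting, hH, h1]
  · have hp : p ∈ S := hT.2 hTq hq
    simp only [hTq, hp, dite_true] at hδ
    obtain ⟨h1, h2⟩ := ht.step hδ
    have hstep : TM0.step T ⟨q, t⟩ = some ⟨p, t.write a⟩ := by simp [TM0.step, hTq]
    rw [hstep]
    have hδ' : M.δ (M.step c).state ((M.step c).tape (M.step c).head) =
        (.inl (.sim ⟨p, hp⟩), some (((M.step c).tape (M.step c).head).getD default), false) := by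
      rw [h1]; rfl
    obtain ⟨h3, h4⟩ := h2.step hδ'
    refine ⟨M.step (M.step c), ⟨⟨hp, h3⟩, ?_⟩, .tail (.single (b := M.step c) ?_) ?_⟩
    · rw [h2.head_eq] at h4
      simpa using h4
    · simp [stepUnlessHalting, hH, h1]
    · simp [stepUnlessHalting, hH, h3]

/-- The tape, seen with the head on the cell to the left of the word `l`. -/
def leftOf (l : List G) : Tape G := Tape.mk' ∅ (ListBlank.cons default (ListBlank.mk l))

theorem cons_default_empty : ListBlank.cons default (∅ : ListBlank G) = ∅ := by
  conv_rhs => rw [← ListBlank.cons_head_tail (∅ : ListBlank G)]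
  rfl

theorem leftOf_write_move (l : List G) (a : G) :
    ((leftOf l).write a).move Dir.left = leftOf (a :: l) := by
  simp only [leftOf, Tape.write_mk', Tape.move_left_mk', ListBlank.cons_mk]
  rfl

/-- The state `inr j` puts `j + 1` letters `b` in front of the word to the right of the head. -/
theorem simulator_haltsFrom_writing {c : Cfg (Control S ⊕ Fin (m + 1)) (Option G)} {l : List G}
    (j : Fin (m + 1)) (hc : c.state = .inr j) (ht : c.Shows (leftOf l)) :
    ∃ c' : Cfg (Control S ⊕ Fin (m + 1)) (Option G),
      c'.state = .inl .writeSnd ∧ c'.Shows (leftOf (List.replicate (j + 1) b ++ l)) ∧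
      ((simulator T S hS b₁ b₂ b m).HaltsFrom c' ↔ (simulator T S hS b₁ b₂ b m).HaltsFrom c) := by
  set M := simulator T S hS b₁ b₂ b m with hM
  have hH (x) : M.IsHalted x ↔ x.state = .inl .accept ∨ x.state = .inl .reject := .rfl
  obtain ⟨j, hj⟩ := j
  have hnot : ¬ M.IsHalted c := by simp [hH, hc]
  induction j generalizing c l with
  | zero =>
    have hδ : M.δ c.state (c.tape c.head) = (.inl .writeSnd, some b, false) := by rw [hc]; rfl
    obtain ⟨h1, h2⟩ := ht.step hδ
    exact ⟨M.step c, h1, by simpa [leftOf_write_move] using h2, M.haltsFrom_step_iff hnot⟩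
  | succ j ih =>
    have hδ : M.δ c.state (c.tape c.head) = (.inr ⟨j, by omega⟩, some b, false) := by rw [hc]; rfl
    obtain ⟨h1, h2⟩ := ht.step hδ
    rw [← M.haltsFrom_step_iff hnot]
    simp only [Bool.false_eq_true, if_false, leftOf_write_move] at h2
    obtain ⟨c', h3, h4, h5⟩ := ih h2 (by omega) h1 (by simp [hH, h1])
    refine ⟨c', h3, ?_, h5⟩
    rw [List.replicate_succ' (n := j + 1), List.append_assoc]
    exact h4

theorem simulator_haltsFrom_init (hT : TM0.Supports T S) :
    (simulator T S hS b₁ b₂ b m).HaltsFrom ((simulator T S hS b₁ b₂ b m).init []) ↔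
      (TM0.eval T (b₁ :: b₂ :: List.replicate (m + 1) b)).Dom := by
  set M := simulator T S hS b₁ b₂ b m with hM
  have hH (x) : M.IsHalted x ↔ x.state = .inl .accept ∨ x.state = .inl .reject := .rfl
  have ht0 : (M.init []).Shows (leftOf ([] : List G)) := by
    have h : leftOf ([] : List G) = default := congrArg (Tape.mk' ∅) cons_default_empty
    intro i
    rw [h]
    rcases i with (_ | i) | i <;> simp [init, hM, simulator] <;> rfl
  obtain ⟨c, hc, ht, hcM⟩ :=
    simulator_haltsFrom_writing T S hS b₁ b₂ b m (Fin.last m) rfl ht0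
  rw [← hM] at hcM
  have hδ : M.δ c.state (c.tape c.head) = (.inl .writeFst, some b₂, false) := by rw [hc]; rfl
  obtain ⟨hc', ht'⟩ := ht.step hδ
  have hδ' : M.δ (M.step c).state ((M.step c).tape (M.step c).head) =
      (.inl .enter, some b₁, false) := by rw [hc']; rfl
  obtain ⟨hc₂, ht₂⟩ := ht'.step hδ'
  set c₂ := M.step (M.step c) with hc₂'
  have hδ₂ : M.δ c₂.state (c₂.tape c₂.head) =
      (.inl (.sim ⟨default, hS⟩), some ((c₂.tape c₂.head).getD default), true) := by
    rw [hc₂]; rfl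
  obtain ⟨hc₃, ht₃⟩ := ht₂.step hδ₂
  rw [← hcM, ← M.haltsFrom_step_iff (by simp [hH, hc]),
    ← M.haltsFrom_step_iff (by simp [hH, hc']),
    ← M.haltsFrom_step_iff (by simp [← hc₂', hH, hc₂]), ← hc₂']
  have hrep : Represents S m
      (TM0.init (b₁ :: b₂ :: List.replicate (m + 1) b)) (M.step c₂) := by
    refine ⟨⟨hS, hc₃⟩, ?_⟩
    rw [ht₂.head_eq] at ht₃
    simp only [Bool.false_eq_true, if_false, leftOf_write_move, if_true, List.append_nil,
      Tape.write_self, Fin.val_last] at ht₃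
    simp only [leftOf, Tape.move_right_mk', ListBlank.head_cons, ListBlank.tail_cons,
      cons_default_empty] at ht₃
    exact ht₃
  rw [← M.eval_stepUnlessHalting_dom (by simp [hH, hc₃]),
    tr_eval_dom (simulator_respects T S hS b₁ b₂ b m hT) hrep]
  rfl

end Simulation

end Simulator

/-! ### The code of the simulator is a primitive recursive function of the length of the word -/

section Code

variable {Λ G : Type} [Inhabited Λ] [Inhabited G] (T : TM0.Machine G Λ) (S : Set Λ)
  (hS : default ∈ S) [DecidablePred (· ∈ S)] (b₁ b₂ b : G) {k s : ℕ}
  (e : Control S ≃ Fin k) (f : Option G ≃ Fin s)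

/-- The simulator as a `FiniteTM`: the states of `Control S` come first in the numbering given
by `e`, and the states that write the letters `b` follow. -/
def finiteSimulator (m : ℕ) : FiniteTM where
  numStates := k + (m + 1)
  numSymbols := s
  tm := (simulator T S hS b₁ b₂ b m).relabel
    ((Equiv.sumCongr e (Equiv.refl _)).trans finSumFinEquiv) f

/-- The transition table is a constant table followed by the rows of the states that write the
letters `b`; the number of these rows, but none of their entries, depends on `m`. -/
theorem finiteSimulator_code (m : ℕ) :
    (finiteSimulator T S hS b₁ b₂ b e f m).code =
      (k + (m + 1), s,
        ((List.finRange s).filter (· ∈ ({none} : Finset (Option G)).map f.toEmbedding)).map Fin.val,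
        (f (some default)).val, (k + m, (e .accept).val, (e .reject).val),
        (List.ofFn fun q : Fin k => List.ofFn fun a : Fin s =>
          let r := controlStep T S hS b₁ b₂ (e.symm q) (f.symm a)
          ((e r.1).val, (f r.2.1).val, r.2.2)) ++
        (List.range (m + 1)).map fun j => List.ofFn fun _ : Fin s =>
          (if j = 0 then (e .writeSnd).val else k + (j - 1), (f (some b)).val, false)) := by
  simp only [FiniteTM.code, Prod.mk.injEq]
  refine ⟨rfl, rfl, ?_, rfl, ⟨rfl, rfl, rfl⟩, ?_⟩
  · rfl
  · refine (List.ofFn_add (n := k) (m := m + 1)).trans (congrArg₂ (· ++ ·) ?_ ?_)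
    · refine congrArg List.ofFn (funext fun q => congrArg List.ofFn (funext fun a => ?_))
      have hq : finSumFinEquiv.symm (Fin.castLE (Nat.le_add_right k (m + 1)) q) =
        (Sum.inl q : Fin k ⊕ Fin (m + 1)) := finSumFinEquiv_symm_apply_castAdd q
      simp [finiteSimulator, OneTapeTM.relabel, simulator, hq]
    · refine List.ext_getElem (by simp) fun j hj _ => ?_
      simp only [List.getElem_ofFn, List.getElem_map, List.getElem_range]
      refine congrArg List.ofFn (funext fun a => ?_)
      simp only [finiteSimulator, OneTapeTM.relabel, simulator, Equiv.symm_trans_apply,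
        finSumFinEquiv_symm_apply_natAdd, Equiv.sumCongr_symm, Equiv.sumCongr_apply, Sum.map_inr,
        Equiv.refl_symm, Equiv.refl_apply]
      split_ifs <;> rfl

theorem primrec_finiteSimulator_code :
    Primrec fun m => (finiteSimulator T S hS b₁ b₂ b e f m).code := by
  simp only [finiteSimulator_code]
  have hadd : Primrec fun m : ℕ => k + m := Primrec.nat_add.comp (.const k) .id
  have hrow : Primrec fun j : ℕ => List.ofFn fun _ : Fin s =>
      (if j = 0 then (e .writeSnd).val else k + (j - 1), (f (some b)).val, false) :=
    Primrec.list_ofFn fun _ =>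
      .pair (.ite (Primrec.eq.comp .id (.const 0)) (.const _) (hadd.comp .pred)) (.const _)
  exact .pair (hadd.comp .succ) (.pair (.const _) (.pair (.const _) (.pair (.const _)
    (.pair (.pair hadd (.const _)) (Primrec.list_append.comp (.const _)
      (Primrec.list_map (Primrec.list_range.comp .succ) (hrow.comp .snd).to₂))))))

end Code

/-- For each `TM0` machine with finite support there are one-tape machines that ignore their input and
halt if and only if the `TM0` machine halts on a given word of length depending on `m`; their codes
are a primitive recursive function of `m`, although the simulated machine need not be explicit. -/
theorem exists_primrec_simulation {Λ G : Type} [Inhabited Λ] [Inhabited G] [Finite G]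
    (T : TM0.Machine G Λ) {S : Finset Λ} (hT : TM0.Supports T S) (b₁ b₂ b : G) :
    ∃ M : ℕ → FiniteTM, Primrec (fun m => (M m).code) ∧ ∀ m, (M m).tm.IgnoresInput ∧
      ((M m).tm.HaltsFrom ((M m).tm.init []) ↔
        (TM0.eval T (b₁ :: b₂ :: List.replicate (m + 1) b)).Dom) := by
  classical
  obtain ⟨k, ⟨e⟩⟩ := Finite.exists_equiv_fin (Control (S : Set Λ))
  obtain ⟨s, ⟨f⟩⟩ := Finite.exists_equiv_fin (Option G)
  refine ⟨finiteSimulator T S hT.1 b₁ b₂ b e f, primrec_finiteSimulator_code .., fun m =>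
    ⟨(simulator_ignoresInput T S hT.1 b₁ b₂ b m).relabel _ _, ?_⟩⟩
  exact (OneTapeTM.relabel_haltsFrom_init_nil _ _ _).trans
    (simulator_haltsFrom_init T S hT.1 b₁ b₂ b m hT)

/-! ### A `TM0` machine for a partial recursive function -/

instance : Finite PartrecToTM2.K' := by
  refine Finite.of_surjective
    (![.main, .rev, .aux, .stack] : Fin 4 → PartrecToTM2.K') ?_
  rintro (_ | _ | _ | _)
  exacts [⟨0, rfl⟩, ⟨1, rfl⟩, ⟨2, rfl⟩, ⟨3, rfl⟩]

/-- Powers of two have uniform binary representations (least significant bit first), so that the words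
to be written on the tape depend on a number only through the length of a constant block. -/
theorem trNat_two_pow (m : ℕ) :
    PartrecToTM2.trNat (2 ^ m) = List.replicate m .bit0 ++ [.bit1] := by
  have h : ∀ m, ∃ p : PosNum, ((2 ^ m : ℕ) : Num) = Num.pos p ∧
      PartrecToTM2.trPosNum p = List.replicate m .bit0 ++ [.bit1] := by
    intro m
    induction m with
    | zero => exact ⟨1, rfl, rfl⟩
    | succ m ih =>
      obtain ⟨p, hp, hp'⟩ := ih
      refine ⟨p.bit0, ?_, by simp [PartrecToTM2.trPosNum, hp', List.replicate_succ]⟩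
      have : ((2 ^ (m + 1) : ℕ) : Num) = Num.bit0 ((2 ^ m : ℕ) : Num) := by
        rw [pow_succ, mul_two, ← Num.bit0_of_bit0, Nat.cast_add]
      rw [this, hp]
      rfl
  obtain ⟨p, hp, hp'⟩ := h m
  rw [PartrecToTM2.trNat, hp]
  exact hp'

theorem primrec_log_two : Primrec (Nat.log 2) := by
  have hpow : Primrec₂ fun x y : ℕ => x ^ y := Primrec₂.unpaired'.1 Nat.Primrec.pow
  have hle : PrimrecRel fun n k : ℕ => 2 ^ k ≤ n :=
    Primrec.nat_le.comp (hpow.comp (.const 2) .snd) .fst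
  refine (Primrec.nat_findGreatest .id hle).of_eq fun n => ?_
  rcases eq_or_ne n 0 with rfl | hn
  · rfl
  · refine Nat.findGreatest_eq_iff.2 ⟨Nat.log_le_self 2 n, fun _ => Nat.pow_log_le_self 2 hn,
      fun k hk _ => not_le.2 (Nat.lt_pow_of_log_lt one_lt_two hk)⟩

/-- A fixed `TM0` machine halts on the words `b₁ b₂ b ⋯ b` with `m` letters `b` exactly for the `m` in
the domain of `f`. It is obtained from Mathlib's compilation of `n ↦ f (log₂ n)` into a stack
machine, a `TM1` machine and a `TM0` machine, and the word is the encoding of the input `2 ^ m`. -/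
theorem exists_TM0_eval_dom_iff {f : ℕ →. ℕ} (hf : Partrec f) :
    ∃ (Λ G : Type) (_ : Inhabited Λ) (_ : Inhabited G) (_ : Finite G) (T : TM0.Machine G Λ)
      (S : Finset Λ) (b₁ b₂ b : G), TM0.Supports T S ∧
      ∀ m, (TM0.eval T (b₁ :: b₂ :: List.replicate m b)).Dom ↔ (f m).Dom := by
  have hg : Partrec fun n => f (Nat.log 2 n) := hf.comp primrec_log_two.to_comp
  obtain ⟨c, hc⟩ := ToPartrec.Code.exists_code (Nat.Partrec'.part_iff₁.2 hg)
  -- The stack machine starts in the default state, which has to be the one that evaluates `c`.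
  let _ : Inhabited PartrecToTM2.Λ' := ⟨PartrecToTM2.trNormal c .halt⟩
  let Γ (_ : PartrecToTM2.K') : Type := PartrecToTM2.Γ'
  let tr : PartrecToTM2.Λ' → TM2.Stmt Γ PartrecToTM2.Λ' (Option PartrecToTM2.Γ') :=
    PartrecToTM2.tr
  let sym (x : PartrecToTM2.Γ') : ∀ k, Option (Γ k) := Function.update (fun _ => none) .main (some x)
  refine ⟨_, TM2to1.Γ' PartrecToTM2.K' Γ, inferInstance, inferInstance,
    inferInstanceAs (Finite (Bool × (PartrecToTM2.K' → Option PartrecToTM2.Γ'))),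
    TM1to0.tr (TM2to1.tr tr), TM1to0.trStmts _ (TM2to1.trSupp tr (PartrecToTM2.codeSupp c .halt)),
    (true, sym .cons), (false, sym .bit1), (false, sym .bit0),
    TM1to0.tr_supports _ (TM2to1.tr_supports _ (PartrecToTM2.tr_supports c .halt)), fun m => ?_⟩
  have hL : ((true, sym .cons) :: (false, sym .bit1) :: List.replicate m (false, sym .bit0) :
      List (TM2to1.Γ' PartrecToTM2.K' Γ)) =
      TM2to1.trInit (Γ := Γ) .main (PartrecToTM2.trList [2 ^ m]) := by
    have hrev : (PartrecToTM2.trList [2 ^ m]).reverse =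
        .cons :: .bit1 :: List.replicate m .bit0 := by
      simp [PartrecToTM2.trList, trNat_two_pow]
    unfold TM2to1.trInit
    rw [hrev]
    exact congrArg (fun l => (true, sym .cons) :: (false, sym .bit1) :: l)
      (List.map_replicate (f := fun a => (false, sym a)) (a := .bit0)).symm
  have hinit : PartrecToTM2.init c [2 ^ m] = TM2.init (Γ := Γ) (Λ := PartrecToTM2.Λ')
      (σ := Option PartrecToTM2.Γ') .main (PartrecToTM2.trList [2 ^ m]) := by
    refine congrArg (TM2.Cfg.mk _ _) (funext fun k => ?_)
    rcases k <;> rfl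
  calc _ ↔ (TM1.eval (TM2to1.tr tr)
          (TM2to1.trInit (Γ := Γ) .main (PartrecToTM2.trList [2 ^ m]))).Dom :=
        iff_of_eq (congrArg Part.Dom ((congrArg (TM0.eval _) hL).trans (TM1to0.tr_eval _ _)))
    _ ↔ (TM2.eval tr .main (PartrecToTM2.trList [2 ^ m])).Dom := TM2to1.tr_eval_dom _ _ _
    _ ↔ (eval (TM2.step PartrecToTM2.tr) (PartrecToTM2.init c [2 ^ m])).Dom := by
        rw [hinit]
        rfl
    _ ↔ (c.eval [2 ^ m]).Dom := iff_of_eq (congrArg Part.Dom (PartrecToTM2.tr_eval c [2 ^ m]))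
    _ ↔ (f (Nat.log 2 (2 ^ m))).Dom := iff_of_eq (congrArg Part.Dom (hc ⟨[2 ^ m], rfl⟩))
    _ ↔ (f m).Dom := by rw [Nat.log_pow one_lt_two]

/-! ### Undecidability -/

/-- A decision procedure would decide which codes of partial recursive functions halt on the
input `0`. -/
theorem not_decidableProblem_haltOne {F : Set (ℕ → ℝ≥0)} (hF : HasArbitrarilyLargeConstants F) :
    ¬ DecidableProblem (haltOne F) := by
  rintro ⟨D, hD, hdec⟩
  -- The shift by one compensates for the block `b ⋯ b` being nonempty.
  have hu : Partrec fun n : ℕ =>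
      Nat.Partrec.Code.eval (Denumerable.ofNat Nat.Partrec.Code (n - 1)) 0 :=
    Nat.Partrec.Code.eval_part.comp ((Computable.ofNat _).comp Primrec.pred.to_comp) (.const 0)
  obtain ⟨Λ, G, _, _, _, T, S, b₁, b₂, b, hT, hdom⟩ := exists_TM0_eval_dom_iff hu
  obtain ⟨M, hM, hsim⟩ := exists_primrec_simulation T hT b₁ b₂ b
  refine ComputablePred.halting_problem 0 ?_
  have key (c : Nat.Partrec.Code) : (c.eval 0).Dom ↔ M (Encodable.encode c) ∈ haltOne F := by
    rw [mem_haltOne_iff_haltsFrom hF (hsim _).1, (hsim _).2, hdom]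
    simp
  classical
  refine ⟨inferInstance, ?_⟩
  have hcomp : Partrec fun c : Nat.Partrec.Code => D (M (Encodable.encode c)).code :=
    hD.comp (hM.to_comp.comp .encode)
  refine hcomp.of_eq fun c => Part.eq_some_iff.2 ?_
  by_cases h : (c.eval 0).Dom
  · simpa [h] using (hdec _).1 ((key c).1 h)
  · simpa [h] using (hdec _).2 (mt (key c).2 h)

theorem bigO_hasArbitrarilyLargeConstants {T : ℕ → ℝ≥0} (hT : T ∈ bigOmega fun _ => 1) :
    HasArbitrarilyLargeConstants (bigO T) := by
  obtain ⟨k, hk, n₀, h⟩ := hT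
  intro K
  refine ⟨K + 1, by simp, (K + 1) / k, by positivity, n₀, fun n hn => ?_⟩
  calc K + 1 = (K + 1) / k * k := (div_mul_cancel₀ _ hk.ne').symm
    _ ≤ (K + 1) / k * T n := by gcongr; simpa using h n hn

theorem mainTheorem4 :
    (∀ F : Set (ℕ → ℝ≥0), HasArbitrarilyLargeConstants F → ¬ DecidableProblem (haltOne F)) ∧
    ¬ DecidableProblem (haltOne polyClass) ∧
    ¬ DecidableProblem (haltOne expClass) ∧
    ¬ DecidableProblem (haltOne simpleExpClass) ∧
    (∀ T : ℕ → ℝ≥0, T ∈ bigOmega (fun _ => 1) → ¬ DecidableProblem (haltOne (bigO T))) ∧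
    ¬ DecidableProblem (haltOne (bigO (fun _ => 1))) := by
  refine ⟨fun F => not_decidableProblem_haltOne, not_decidableProblem_haltOne ?_,
    not_decidableProblem_haltOne ?_, not_decidableProblem_haltOne ?_,
    fun T hT => not_decidableProblem_haltOne (bigO_hasArbitrarilyLargeConstants hT),
    not_decidableProblem_haltOne (bigO_hasArbitrarilyLargeConstants ?_)⟩
  · exact fun K => ⟨K, le_rfl, .C (K : ℝ), by simp⟩
  · intro K
    have hK : (0 : ℝ) < K + 1 := by positivity
    -- The constant `0` is not of the form `2 ^ p(n)`, hence `K + 1` instead of `K`.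
    refine ⟨K + 1, by simp, .C (Real.logb 2 (K + 1)), fun n => ?_⟩
    simp [Real.rpow_logb, hK]
  · exact fun K => ⟨K, le_rfl, 1, K, by simp⟩
  · exact ⟨1, one_pos, 0, by simp⟩
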